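/- Let $(M_n)_{n\ge 0}$ be a sequence of positive real numbers with $M_0=1$ and $\frac{M_{n+m}}{M_nM_m}\ge\binom{n+m}{n}$ for all $n,m\ge 0$, and suppose that $(M_n)$ is non-quasi-analytic, i.e. $\sum_{n\ge 0} \frac{M_n}{M_{n+1}}<\infty$. Let $$D([0,1],M)=\Big\{f\in C^\infty([0,1],\mathbb C):\ \|f\|_D=\sum_{n=0}^\infty\frac{\|f^{(n)}\|_\infty}{M_n}<\infty\Big\},$$ a normed algebra under pointwise operations and the norm $\|\cdot\|_D$ (derivatives at $0$ and $1$ are one-sided, and $\|\cdot\|_\infty$ is the supremum norm on $[0,1]$). Let $\varphi:[0,1]\to[0,1]$ be a map that induces a compact endomorphism of $D([0,1],M)$; that is, $f\circ\varphi\in D([0,1],M)$ for every $f\in D([0,1],M)$, and the algebra endomorphism $f\mapsto f\circ\varphi$ of $D([0,1],M)$ is a compact operator. Then $\varphi$ is differentiable on $[0,1]$ and $$|\varphi'(x)|<1\quad\text{for every }x\in(0,1).$$ Consequently, if in addition $|\varphi'|$ attains its maximum over $[0,1]$ at some point of $(0,1)$, then $\|\varphi'\|_\infty=\sup_{x\in[0,1]}|\varphi'(x)|<1$.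 -/

import Mathlib

open Set (Icc range IccExtend)

/-- A weight (algebra) sequence: positive reals `M 0, M 1, …` with `M 0 = 1` and
`M (n + m) / (M n * M m) ≥ (n + m choose n)`. -/
structure WeightSeq where
  /-- the terms of the sequence -/
  seq : ℕ → ℝ
  pos : ∀ n, 0 < seq n
  zero_eq_one : seq 0 = 1
  choose_le : ∀ n m, ((n + m).choose n : ℝ) ≤ seq (n + m) / (seq n * seq m)

/-- Non-quasi-analyticity: `∑ M n / M (n + 1) < ∞`. -/
def WeightSeq.NonQuasiAnalytic (M : WeightSeq) : Prop :=
  Summable fun n => M.seq n / M.seq (n + 1)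

namespace DAlg

noncomputable section

variable {a b : ℝ}

/-- `f` is infinitely differentiable on the compact interval `[a, b]` (one-sided derivatives at the
endpoints). The values of `IccExtend` outside `[a, b]` play no role. -/
def Smooth (hab : a < b) (f : Icc a b → ℂ) : Prop :=
  ContDiffOn ℝ (⊤ : ℕ∞) (IccExtend hab.le f) (Icc a b)

/-- The `n`-th derivative of `f` on `[a, b]`, one-sided at the endpoints. -/
def nthDeriv (hab : a < b) (n : ℕ) (f : Icc a b → ℂ) (x : Icc a b) : ℂ :=
  iteratedDerivWithin n (IccExtend hab.le f) (Icc a b) x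

/-- The uniform norm over `[a, b]` of the `n`-th derivative of `f`. -/
def derivSup (hab : a < b) (n : ℕ) (f : Icc a b → ℂ) : ℝ :=
  ⨆ x : Icc a b, ‖nthDeriv hab n f x‖

lemma iccExtend_add (hab : a < b) (f g : Icc a b → ℂ) :
    IccExtend hab.le (f + g) = IccExtend hab.le f + IccExtend hab.le g := rfl

lemma iccExtend_smul (hab : a < b) (c : ℂ) (f : Icc a b → ℂ) :
    IccExtend hab.le (c • f) = c • IccExtend hab.le f := rfl

lemma nthDeriv_add (hab : a < b) (n : ℕ) {f g : Icc a b → ℂ} (hf : Smooth hab f)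
    (hg : Smooth hab g) (x : Icc a b) :
    nthDeriv hab n (f + g) x = nthDeriv hab n f x + nthDeriv hab n g x := by
  unfold nthDeriv
  rw [iccExtend_add hab]
  exact iteratedDerivWithin_add x.2 (uniqueDiffOn_Icc hab)
    ((hf x x.2).of_le (by exact_mod_cast le_top)) ((hg x x.2).of_le (by exact_mod_cast le_top))

lemma nthDeriv_smul (hab : a < b) (n : ℕ) (c : ℂ) {f : Icc a b → ℂ} (hf : Smooth hab f)
    (x : Icc a b) : nthDeriv hab n (c • f) x = c * nthDeriv hab n f x := by
  unfold nthDeriv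
  rw [iccExtend_smul hab]
  exact iteratedDerivWithin_const_smul x.2 (uniqueDiffOn_Icc hab) c
    ((hf x x.2).of_le (by exact_mod_cast le_top))

lemma norm_nthDeriv_mul_le (hab : a < b) (n : ℕ) {f g : Icc a b → ℂ} (hf : Smooth hab f)
    (hg : Smooth hab g) (x : Icc a b) :
    ‖nthDeriv hab n (f * g) x‖ ≤ ∑ i ∈ Finset.range (n + 1),
      (n.choose i : ℝ) * ‖nthDeriv hab i f x‖ * ‖nthDeriv hab (n - i) g x‖ := by
  unfold nthDeriv
  simp only [← norm_iteratedFDerivWithin_eq_norm_iteratedDerivWithin]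
  exact norm_iteratedFDerivWithin_mul_le hf hg (uniqueDiffOn_Icc hab) x.2
    (by exact_mod_cast le_top)

lemma bddAbove_nthDeriv (hab : a < b) (n : ℕ) {f : Icc a b → ℂ} (hf : Smooth hab f) :
    BddAbove (range fun x : Icc a b => ‖nthDeriv hab n f x‖) := by
  have h := (hf.continuousOn_iteratedDerivWithin (m := n) (by exact_mod_cast le_top)
    (uniqueDiffOn_Icc hab)).norm
  have h2 := isCompact_Icc.bddAbove_image h
  rwa [Set.image_eq_range] at h2

lemma norm_le_derivSup (hab : a < b) (n : ℕ) {f : Icc a b → ℂ} (hf : Smooth hab f)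
    (x : Icc a b) : ‖nthDeriv hab n f x‖ ≤ derivSup hab n f :=
  le_ciSup (bddAbove_nthDeriv hab n hf) x

lemma derivSup_nonneg (hab : a < b) (n : ℕ) (f : Icc a b → ℂ) : 0 ≤ derivSup hab n f :=
  Real.iSup_nonneg fun _ => norm_nonneg _

lemma derivSup_le (hab : a < b) {n : ℕ} {f : Icc a b → ℂ} {C : ℝ}
    (h : ∀ x, ‖nthDeriv hab n f x‖ ≤ C) : derivSup hab n f ≤ C :=
  have : Nonempty (Icc a b) := ⟨⟨a, Set.left_mem_Icc.2 hab.le⟩⟩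
  ciSup_le h

lemma derivSup_add_le (hab : a < b) (n : ℕ) {f g : Icc a b → ℂ} (hf : Smooth hab f)
    (hg : Smooth hab g) : derivSup hab n (f + g) ≤ derivSup hab n f + derivSup hab n g :=
  derivSup_le hab fun x => by
    rw [nthDeriv_add hab n hf hg]
    exact (norm_add_le _ _).trans
      (add_le_add (norm_le_derivSup hab n hf x) (norm_le_derivSup hab n hg x))

lemma derivSup_smul (hab : a < b) (n : ℕ) (c : ℂ) {f : Icc a b → ℂ} (hf : Smooth hab f) :
    derivSup hab n (c • f) = ‖c‖ * derivSup hab n f := by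
  unfold derivSup
  simp_rw [nthDeriv_smul hab n c hf, norm_mul]
  exact (Real.mul_iSup_of_nonneg (norm_nonneg c) _).symm

lemma smooth_const (hab : a < b) (c : ℂ) : Smooth hab (fun _ => c) := contDiffOn_const

lemma smooth_add (hab : a < b) {f g : Icc a b → ℂ} (hf : Smooth hab f)
    (hg : Smooth hab g) : Smooth hab (f + g) := ContDiffOn.add hf hg

lemma smooth_mul (hab : a < b) {f g : Icc a b → ℂ} (hf : Smooth hab f)
    (hg : Smooth hab g) : Smooth hab (f * g) := ContDiffOn.mul hf hg

lemma derivSup_const (hab : a < b) (n : ℕ) (c : ℂ) :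
    derivSup hab n (fun _ => c) = if n = 0 then ‖c‖ else 0 := by
  have : Nonempty (Icc a b) := ⟨⟨a, Set.left_mem_Icc.2 hab.le⟩⟩
  have : ∀ x : Icc a b, nthDeriv hab n (fun _ => c) x = if n = 0 then c else 0 := fun x => by
    have h : IccExtend hab.le (fun _ : Icc a b => c) = fun _ => c := rfl
    simp [nthDeriv, h, iteratedDerivWithin_const]
  simp only [derivSup, this, ciSup_const]
  split_ifs <;> simp

/-- The terms `‖f⁽ⁿ⁾‖_∞ / M n` of the norm. -/
def term (hab : a < b) (M : WeightSeq) (f : Icc a b → ℂ) (n : ℕ) : ℝ :=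
  derivSup hab n f / M.seq n

lemma term_nonneg (hab : a < b) (M : WeightSeq) (f : Icc a b → ℂ) (n : ℕ) :
    0 ≤ term hab M f n := div_nonneg (derivSup_nonneg hab n f) (M.pos n).le

lemma term_add_le (hab : a < b) (M : WeightSeq) {f g : Icc a b → ℂ} (hf : Smooth hab f)
    (hg : Smooth hab g) (n : ℕ) :
    term hab M (f + g) n ≤ term hab M f n + term hab M g n := by
  unfold term
  rw [← add_div]
  exact div_le_div_of_nonneg_right (derivSup_add_le hab n hf hg) (M.pos n).le

lemma term_smul (hab : a < b) (M : WeightSeq) (c : ℂ) {f : Icc a b → ℂ} (hf : Smooth hab f)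
    (n : ℕ) : term hab M (c • f) n = ‖c‖ * term hab M f n := by
  unfold term
  rw [derivSup_smul hab n c hf, mul_div_assoc]

lemma term_mul_le (hab : a < b) (M : WeightSeq) {f g : Icc a b → ℂ} (hf : Smooth hab f)
    (hg : Smooth hab g) (n : ℕ) :
    term hab M (f * g) n ≤
      ∑ p ∈ Finset.HasAntidiagonal.antidiagonal n, term hab M f p.1 * term hab M g p.2 := by
  rw [Finset.Nat.sum_antidiagonal_eq_sum_range_succ_mk]
  unfold term
  rw [div_le_iff₀ (M.pos n), Finset.sum_mul]
  refine derivSup_le hab fun x => (norm_nthDeriv_mul_le hab n hf hg x).trans ?_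
  refine Finset.sum_le_sum fun i hi => ?_
  have hin : i + (n - i) = n := by have := Finset.mem_range.1 hi; omega
  have h1 := M.choose_le i (n - i)
  rw [hin] at h1
  have hA := norm_le_derivSup hab i hf x
  have hB := norm_le_derivSup hab (n - i) hg x
  have hA0 := derivSup_nonneg hab i f
  have hB0 := derivSup_nonneg hab (n - i) g
  calc (n.choose i : ℝ) * ‖nthDeriv hab i f x‖ * ‖nthDeriv hab (n - i) g x‖
      ≤ (M.seq n / (M.seq i * M.seq (n - i))) * derivSup hab i f * derivSup hab (n - i) g := by
        have := (Nat.cast_nonneg (α := ℝ) (n.choose i)).trans h1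
        gcongr
    _ = _ := by
        have := (M.pos i).ne'
        have := (M.pos (n - i)).ne'
        field_simp

/-- `D([a, b], M)` as a subalgebra of the algebra of all functions `[a, b] → ℂ` with pointwise
operations: the smooth `f` with `∑ ‖f⁽ⁿ⁾‖_∞ / M n < ∞`. -/
def subalgebra (hab : a < b) (M : WeightSeq) : Subalgebra ℂ (Icc a b → ℂ) where
  carrier := {f | Smooth hab f ∧ Summable (term hab M f)}
  add_mem' {f g} hf hg := ⟨smooth_add hab hf.1 hg.1,
    Summable.of_nonneg_of_le (term_nonneg hab M _) (term_add_le hab M hf.1 hg.1)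
      (hf.2.add hg.2)⟩
  mul_mem' {f g} hf hg := ⟨smooth_mul hab hf.1 hg.1,
    Summable.of_nonneg_of_le (term_nonneg hab M _) (term_mul_le hab M hf.1 hg.1)
      (summable_sum_mul_antidiagonal_of_summable_mul
        (hf.2.mul_of_nonneg hg.2 (term_nonneg hab M f) (term_nonneg hab M g)))⟩
  algebraMap_mem' c := ⟨smooth_const hab c, by
    refine summable_of_ne_finset_zero (s := {0}) fun n hn => ?_
    have h : derivSup hab n (algebraMap ℂ (Icc a b → ℂ) c) = if n = 0 then ‖c‖ else 0 :=
      derivSup_const hab n c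
    have hn' : n ≠ 0 := by simpa using hn
    simp [term, h, hn']⟩

end

end DAlg

/-- The algebra `D([a, b], M)` of the infinitely differentiable `f : [a, b] → ℂ` with
`∑ ‖f⁽ⁿ⁾‖_∞ / M n < ∞`. It is a type of its own so that the only topology on it is that of its
norm, and not the topology of pointwise convergence. -/
def DAlg {a b : ℝ} (hab : a < b) (M : WeightSeq) : Type := DAlg.subalgebra hab M

namespace DAlg

noncomputable section

variable {a b : ℝ} {hab : a < b} {M : WeightSeq}

instance : CommRing (DAlg hab M) := inferInstanceAs (CommRing (subalgebra hab M))

instance : Algebra ℂ (DAlg hab M) := inferInstanceAs (Algebra ℂ (subalgebra hab M))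

instance : CoeFun (DAlg hab M) fun _ => Icc a b → ℂ := ⟨fun f => f.1⟩

/-- `‖f‖_D = ∑ ‖f⁽ⁿ⁾‖_∞ / M n`. -/
instance : Norm (DAlg hab M) := ⟨fun f => ∑' n, derivSup hab n f / M.seq n⟩

lemma norm_eq (f : DAlg hab M) : ‖f‖ = ∑' n, term hab M f n := rfl

lemma norm_smul_eq (c : ℂ) (f : DAlg hab M) : ‖c • f‖ = ‖c‖ * ‖f‖ := by
  rw [norm_eq, norm_eq, ← tsum_mul_left]
  exact tsum_congr fun n => term_smul hab M c f.2.1 n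

instance : NormedCommRing (DAlg hab M) :=
  let N : RingNorm (DAlg hab M) :=
    { toFun := fun f => ‖f‖
      map_zero' := by
        have := norm_smul_eq (0 : ℂ) (0 : DAlg hab M)
        rwa [norm_zero, zero_mul, zero_smul] at this
      add_le' := fun f g => by
        rw [norm_eq, norm_eq, norm_eq, ← f.2.2.tsum_add g.2.2]
        exact (f + g).2.2.tsum_le_tsum (term_add_le hab M f.2.1 g.2.1) (f.2.2.add g.2.2)
      neg' := fun f => by
        have := norm_smul_eq (-1 : ℂ) f
        rwa [neg_smul, one_smul, norm_neg, norm_one, one_mul] at this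
      mul_le' := fun f g => by
        have hs := f.2.2.mul_of_nonneg g.2.2 (term_nonneg hab M f) (term_nonneg hab M g)
        rw [norm_eq, norm_eq, norm_eq, f.2.2.tsum_mul_tsum_eq_tsum_sum_antidiagonal g.2.2 hs]
        exact (f * g).2.2.tsum_le_tsum (term_mul_le hab M f.2.1 g.2.1)
          (summable_sum_mul_antidiagonal_of_summable_mul hs)
      eq_zero_of_map_eq_zero' := fun f hf => by
        have h0 : term hab M f 0 ≤ 0 :=
          (f.2.2.le_tsum 0 fun n _ => term_nonneg hab M f n).trans (le_of_eq hf)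
        have h1 : derivSup hab 0 f ≤ 0 := by
          simpa [term, M.zero_eq_one] using h0
        refine Subtype.ext (funext fun x => ?_)
        have h2 := (norm_le_derivSup hab 0 f.2.1 x).trans h1
        have h3 : nthDeriv hab 0 f x = f x := by simp [nthDeriv]
        rw [h3] at h2
        exact norm_le_zero_iff.1 h2 }
  { N.toNormedRing, (inferInstance : CommRing (DAlg hab M)),
    (inferInstance : Norm (DAlg hab M)) with }

instance : NormedAlgebra ℂ (DAlg hab M) where
  norm_smul_le c f := (norm_smul_eq c f).le

end

/-- The selfmap `φ` of `[a, b]` induces a compact endomorphism of `D([a, b], M)`: there is an algebra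
endomorphism `T` of `D([a, b], M)` with `T f = f ∘ φ` for all `f`, and `T` is a compact operator. -/
def InducesCompactEndomorphism {a b : ℝ} (hab : a < b) (M : WeightSeq)
    (φ : Icc a b → Icc a b) : Prop :=
  ∃ T : DAlg hab M →ₐ[ℂ] DAlg hab M,
    (∀ (f : DAlg hab M) (x : Icc a b), T f x = f (φ x)) ∧ IsCompactOperator T

/-- The real function on the line that extends a selfmap of `[a, b]`; only its values on `[a, b]`
are used. -/
noncomputable def realMap {a b : ℝ} (hab : a < b) (φ : Icc a b → Icc a b) : ℝ → ℝ :=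
  IccExtend hab.le fun x => (φ x : ℝ)

/-- The derivative `φ'` of a selfmap `φ` of `[a, b]`, one-sided at the endpoints. -/
noncomputable def selfmapDeriv {a b : ℝ} (hab : a < b) (φ : Icc a b → Icc a b)
    (x : Icc a b) : ℝ :=
  derivWithin (realMap hab φ) (Icc a b) x

end DAlg

/-! Suppose `|φ' x₀| ≥ 1` at an interior point `x₀`, and put `y₀ = φ x₀`. Among the functions with
leading term `(x - x₀) ^ n` at `x₀`, choose `f n` whose norm is within a factor 2 of the infimum
(`exists_almost_minimal`). Cut `f n` off near `x₀` and translate it to `y₀`; this costs a constant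
factor `C` independent of `n` (`exists_localized_translate`). After division by `‖f n‖` the results
`u n` stay in a fixed ball, and `T (u n)` has at `x₀` the leading coefficient `χ y₀ * φ' x₀ ^ n / ‖f
n‖` of order `n`. For `n < m`, `T (u n) - T (u m)` has the same coefficient of order `n`, so the
choice of `f n` bounds its norm below by `‖χ y₀‖ * |φ' x₀| ^ n / 2 ≥ ‖χ y₀‖ / 2`. Thus `T (u n)` has
no convergent subsequence and `T` is not compact.

Non-quasi-analyticity supplies the cutoff: an infinite convolution of boxes whose half-widths are
comparable to `M n / M (n + 1)`. The point `x₀` must be interior so that the cut-off function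
extends by zero to the line; `y₀` may be an endpoint. -/

/-! ### Box averages and their infinite convolution -/

/-- The mean of `f` over `[x - a, x + a]`. -/
noncomputable def boxAvg (a : ℝ) (f : ℝ → ℂ) (x : ℝ) : ℂ :=
  (2 * a)⁻¹ • ∫ t in (x - a)..(x + a), f t

lemma norm_boxAvg_le {a C : ℝ} (ha : 0 < a) {f : ℝ → ℂ} {x : ℝ}
    (h : ∀ t, |t - x| ≤ a → ‖f t‖ ≤ C) : ‖boxAvg a f x‖ ≤ C := by
  have h1 : ‖∫ t in (x - a)..(x + a), f t‖ ≤ C * |x + a - (x - a)| := by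
    refine intervalIntegral.norm_integral_le_of_norm_le_const fun t ht => h t ?_
    rw [Set.uIoc_of_le (by linarith)] at ht
    rw [abs_le]
    constructor <;> linarith [ht.1, ht.2]
  have h2 : |x + a - (x - a)| = 2 * a := by
    rw [abs_of_nonneg] <;> linarith
  rw [h2] at h1
  rw [boxAvg, norm_smul, norm_inv, Real.norm_of_nonneg (by linarith), inv_mul_le_iff₀ (by linarith)]
  linarith

lemma boxAvg_sub {a : ℝ} {f g : ℝ → ℂ} (hf : Continuous f) (hg : Continuous g) (x : ℝ) :
    boxAvg a (fun t => f t - g t) x = boxAvg a f x - boxAvg a g x := by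
  rw [boxAvg, boxAvg, boxAvg, intervalIntegral.integral_sub (hf.intervalIntegrable _ _)
    (hg.intervalIntegrable _ _), smul_sub]

lemma boxAvg_const {a : ℝ} (ha : 0 < a) (c : ℂ) (x : ℝ) : boxAvg a (fun _ => c) x = c := by
  rw [boxAvg, intervalIntegral.integral_const, smul_smul]
  have : (2 * a)⁻¹ * (x + a - (x - a)) = 1 := by field_simp; ring
  rw [this, one_smul]

lemma hasDerivAt_boxAvg {f : ℝ → ℂ} (hf : Continuous f) (a x : ℝ) :
    HasDerivAt (boxAvg a f) ((2 * a)⁻¹ • (f (x + a) - f (x - a))) x := by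
  have h : ∀ y, HasDerivAt (fun z => ∫ t in (0 : ℝ)..z, f t) (f y) y := fun y =>
    intervalIntegral.integral_hasDerivAt_right (hf.intervalIntegrable _ _)
      hf.stronglyMeasurable.stronglyMeasurableAtFilter hf.continuousAt
  have h1 : HasDerivAt (fun z => ∫ t in (0 : ℝ)..(z + a), f t) (f (x + a)) x :=
    (h (x + a)).comp_add_const x a
  have h2 : HasDerivAt (fun z => ∫ t in (0 : ℝ)..(z - a), f t) (f (x - a)) x :=
    (h (x - a)).comp_sub_const x a
  have h3 := (h1.sub h2).const_smul (2 * a)⁻¹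
  refine h3.congr_of_eventuallyEq (Filter.Eventually.of_forall fun y => ?_)
  simp only [boxAvg, Pi.smul_apply, Pi.sub_apply]
  rw [intervalIntegral.integral_interval_sub_left (hf.intervalIntegrable _ _)
    (hf.intervalIntegrable _ _)]

lemma continuous_boxAvg {f : ℝ → ℂ} (hf : Continuous f) (a : ℝ) : Continuous (boxAvg a f) :=
  continuous_iff_continuousAt.2 fun x => (hasDerivAt_boxAvg hf a x).continuousAt

lemma norm_boxAvg_sub_self_le {a : ℝ} (ha : 0 < a) {g : ℝ → ℂ} (hg : LipschitzWith 1 g) (x : ℝ) :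
    ‖boxAvg a g x - g x‖ ≤ a := by
  have h : boxAvg a g x - g x = boxAvg a (fun t => g t - g x) x := by
    rw [boxAvg_sub hg.continuous continuous_const, boxAvg_const ha]
  rw [h]
  refine norm_boxAvg_le ha fun t ht => ?_
  have := hg.dist_le_mul t x
  rw [dist_eq_norm, Real.dist_eq] at this
  simp only [NNReal.coe_one, one_mul] at this
  exact this.trans ht

/-- The means over boxes of half-widths `a n, …, a (n + j - 1)`, applied to `g`. -/
noncomputable def boxIter (a : ℕ → ℝ) (g : ℝ → ℂ) : ℕ → ℕ → ℝ → ℂ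
  | 0, _ => g
  | j + 1, n => boxAvg (a n) (boxIter a g j (n + 1))

section boxIter

variable {a : ℕ → ℝ} {g : ℝ → ℂ}

lemma continuous_boxIter (hg : Continuous g) (j n : ℕ) : Continuous (boxIter a g j n) := by
  induction j generalizing n with
  | zero => exact hg
  | succ j ih => exact continuous_boxAvg (ih _) _

lemma norm_boxIter_le (ha : ∀ n, 0 < a n) {C : ℝ} (hC : ∀ x, ‖g x‖ ≤ C) (j n : ℕ) (x : ℝ) :
    ‖boxIter a g j n x‖ ≤ C := by
  induction j generalizing n x with
  | zero => exact hC x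
  | succ j ih => exact norm_boxAvg_le (ha n) fun t _ => ih _ t

/-- The two iterates differ only in the innermost box, which moves the 1-Lipschitz `g` by at most
its half-width; the outer means do not increase the sup norm. -/
lemma norm_boxIter_succ_sub_le (ha : ∀ n, 0 < a n) (hg : LipschitzWith 1 g) (j n : ℕ) (x : ℝ) :
    ‖boxIter a g (j + 1) n x - boxIter a g j n x‖ ≤ a (n + j) := by
  induction j generalizing n x with
  | zero => exact norm_boxAvg_sub_self_le (ha n) hg x
  | succ j ih =>
    have hc := fun j n => continuous_boxIter (a := a) hg.continuous j n
    change ‖boxAvg (a n) (boxIter a g (j + 1) (n + 1)) x - boxAvg (a n) (boxIter a g j (n + 1)) x‖ ≤ _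
    rw [← boxAvg_sub (hc _ _) (hc _ _)]
    refine norm_boxAvg_le (ha n) fun t _ => (ih (n + 1) t).trans (le_of_eq ?_)
    congr 1
    omega

/-- Each mean enlarges the support by at most its half-width. -/
lemma boxIter_eq_zero (ha : ∀ n, 0 < a n) {r : ℝ} (hr : ∀ x, r ≤ |x| → g x = 0) (j n : ℕ) (x : ℝ)
    (hx : r + ∑ i ∈ Finset.range j, a (n + i) ≤ |x|) : boxIter a g j n x = 0 := by
  induction j generalizing n x with
  | zero => exact hr x (by simpa using hx)
  | succ j ih =>
    rw [← norm_le_zero_iff]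
    refine norm_boxAvg_le (ha n) fun t ht => ?_
    rw [ih (n + 1) t, norm_zero]
    rw [Finset.sum_range_succ'] at hx
    have h1 : ∀ i, a (n + 1 + i) = a (n + (i + 1)) := fun i => by congr 1; omega
    simp only [h1]
    have h2 : |x| ≤ |t| + |t - x| := by
      have := abs_sub_abs_le_abs_sub x t
      rw [abs_sub_comm] at this
      linarith
    simp only [add_zero] at hx
    linarith

end boxIter

open Filter Topology in
/-- Infinite convolution of boxes: functions `F n` with
`(F n)' = (F (n + 1) (· + a n) - F (n + 1) (· - a n)) / (2 a n)`, uniformly bounded, the first one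
nonzero at `0` and supported in `[-2d, 2d]`. -/
theorem exists_boxConvolution {a : ℕ → ℝ} (ha : ∀ n, 0 < a n) (hs : Summable a) {d : ℝ}
    (hd : ∑' n, a n < d) :
    ∃ F : ℕ → ℝ → ℂ, (∀ n x, ‖F n x‖ ≤ d) ∧
      (∀ n x, HasDerivAt (F n) ((2 * a n)⁻¹ • (F (n + 1) (x + a n) - F (n + 1) (x - a n))) x) ∧
      F 0 0 ≠ 0 ∧ ∀ x, 2 * d ≤ |x| → F 0 x = 0 := by
  have hd0 : 0 < d := (tsum_nonneg fun n => (ha n).le).trans_lt hd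
  -- A tent of height and half-width `d`: being 1-Lipschitz makes the iterates converge, its height
  -- exceeds the total displacement `∑ a n`, and its support grows to at most `d + ∑ a n ≤ 2 * d`.
  let g : ℝ → ℂ := fun x => ((max 0 (d - |x|) : ℝ) : ℂ)
  have hgn : ∀ x, ‖g x‖ = max 0 (d - |x|) := fun x => by
    simp only [g, Complex.norm_real, Real.norm_eq_abs]
    exact abs_of_nonneg (le_max_left _ _)
  have hgL : LipschitzWith 1 g := by
    refine LipschitzWith.of_dist_le_mul fun x y => ?_
    simp only [g, dist_eq_norm, ← Complex.ofReal_sub, Complex.norm_real, Real.norm_eq_abs,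
      NNReal.coe_one, one_mul]
    refine (abs_max_sub_max_le_max _ _ _ _).trans ?_
    refine max_le (by simp) ?_
    have : d - |x| - (d - |y|) = |y| - |x| := by ring
    rw [this, abs_sub_comm x y]
    exact abs_abs_sub_abs_le _ _
  have hgd : ∀ x, ‖g x‖ ≤ d := fun x => by
    rw [hgn]; exact max_le hd0.le (by linarith [abs_nonneg x])
  have hg0 : ∀ x, d ≤ |x| → g x = 0 := fun x hx => by
    rw [← norm_eq_zero, hgn]; exact max_eq_left (by linarith)
  have hsn : ∀ n, Summable fun j => a (n + j) := fun n => by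
    simpa only [add_comm n] using (summable_nat_add_iff n).2 hs
  have hdist : ∀ n x j, dist (boxIter a g j n x) (boxIter a g j.succ n x) ≤ a (n + j) :=
    fun n x j => by
      rw [dist_comm, dist_eq_norm]; exact norm_boxIter_succ_sub_le ha hgL j n x
  have hlim : ∀ n x, ∃ y, Tendsto (fun j => boxIter a g j n x) atTop (𝓝 y) := fun n x =>
    cauchySeq_tendsto_of_complete (cauchySeq_of_dist_le_of_summable _ (hdist n x) (hsn n))
  choose F hF using hlim
  have hFd : ∀ n x, ‖F n x‖ ≤ d := fun n x =>
    le_of_tendsto (hF n x).norm (Eventually.of_forall fun j => norm_boxIter_le ha hgd j n x)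
  have hFc : ∀ n, Continuous (F n) := fun n => by
    have hu : TendstoUniformly (fun j => boxIter a g j n) (F n) atTop := by
      rw [Metric.tendstoUniformly_iff]
      intro ε hε
      have h0 := tendsto_sum_nat_add fun j => a (n + j)
      filter_upwards [h0.eventually_lt_const hε] with j hj x
      rw [dist_comm]
      refine (dist_le_tsum_of_dist_le_of_tendsto _ (hdist n x) (hsn n) (hF n x) j).trans_lt ?_
      simpa only [add_comm j] using hj
    exact hu.continuous (Frequently.of_forall fun j => continuous_boxIter hgL.continuous j n)
  -- New boxes enter innermost, so the outer mean over `a n` is unchanged as `j → ∞` and passes to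
  -- the limit.
  have hFavg : ∀ n, F n = boxAvg (a n) (F (n + 1)) := fun n => by
    funext x
    refine tendsto_nhds_unique ((tendsto_add_atTop_iff_nat 1).2 (hF n x)) ?_
    refine Tendsto.const_smul ?_ _
    refine intervalIntegral.tendsto_integral_filter_of_dominated_convergence (fun _ => d) ?_ ?_ ?_ ?_
    · exact Eventually.of_forall fun j =>
        (continuous_boxIter hgL.continuous j (n + 1)).aestronglyMeasurable
    · exact Eventually.of_forall fun j => Eventually.of_forall fun t _ =>
        norm_boxIter_le ha hgd j (n + 1) t
    · exact intervalIntegrable_const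
    · exact Eventually.of_forall fun t _ => hF (n + 1) t
  refine ⟨F, hFd, fun n x => ?_, fun h0 => ?_, fun x hx => ?_⟩
  · rw [hFavg n]; exact hasDerivAt_boxAvg (hFc _) _ _
  · have h1 := dist_le_tsum_of_dist_le_of_tendsto₀ _ (hdist 0 0) (hsn 0) (hF 0 0)
    have h2 : boxIter a g 0 0 0 = g 0 := rfl
    rw [h0, dist_zero_right, h2, hgn] at h1
    simp only [abs_zero, sub_zero, zero_add] at h1
    rw [max_eq_right hd0.le] at h1
    linarith
  · refine tendsto_nhds_unique (hF 0 x) ?_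
    have : ∀ j, boxIter a g j 0 x = 0 := fun j => by
      refine boxIter_eq_zero ha hg0 j 0 x ?_
      have := hs.sum_le_tsum (Finset.range j) fun i _ => (ha i).le
      simp only [zero_add]
      linarith
    simp only [this]
    exact tendsto_const_nhds

/-- Each derivative gives a difference of two translates of the next function, divided by `2 * a n`;
the 2 cancels and a factor `(a n)⁻¹` remains. -/
lemma contDiff_and_norm_iteratedDeriv_le {a : ℕ → ℝ} (ha : ∀ n, 0 < a n) {C : ℝ} {F : ℕ → ℝ → ℂ}
    (hC : ∀ n x, ‖F n x‖ ≤ C)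
    (hF : ∀ n x, HasDerivAt (F n) ((2 * a n)⁻¹ • (F (n + 1) (x + a n) - F (n + 1) (x - a n))) x)
    (m n : ℕ) : ContDiff ℝ m (F n) ∧
      ∀ x, ‖iteratedDeriv m (F n) x‖ ≤ C * ∏ i ∈ Finset.range m, (a (n + i))⁻¹ := by
  have hd : ∀ n, deriv (F n) = (2 * a n)⁻¹ •
      ((fun x => F (n + 1) (x + a n)) - fun x => F (n + 1) (x - a n)) :=
    fun n => funext fun x => (hF n x).deriv
  induction m generalizing n with
  | zero =>
    refine ⟨?_, fun x => by simpa using hC n x⟩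
    simp only [Nat.cast_zero, contDiff_zero]
    exact continuous_iff_continuousAt.2 fun x => (hF n x).continuousAt
  | succ m ih =>
    obtain ⟨h1, h2⟩ := ih (n + 1)
    have hp : ContDiff ℝ m fun x => F (n + 1) (x + a n) := h1.comp (contDiff_id.add contDiff_const)
    have hm : ContDiff ℝ m fun x => F (n + 1) (x - a n) := h1.comp (contDiff_id.sub contDiff_const)
    have hpm : ContDiff ℝ m ((fun x => F (n + 1) (x + a n)) - fun x => F (n + 1) (x - a n)) :=
      hp.sub hm
    constructor
    · rw [Nat.cast_add, Nat.cast_one, contDiff_succ_iff_deriv]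
      refine ⟨fun x => (hF n x).differentiableAt, fun h => absurd h (by simp), ?_⟩
      rw [hd]
      exact hpm.const_smul (2 * a n)⁻¹
    · intro x
      rw [iteratedDeriv_succ', hd, iteratedDeriv_const_smul hpm.contDiffAt,
        iteratedDeriv_sub hp.contDiffAt hm.contDiffAt, iteratedDeriv_comp_add_const,
        iteratedDeriv_comp_sub_const, norm_smul, norm_inv,
        Real.norm_of_nonneg (by linarith [ha n]), Finset.prod_range_succ']
      have h3 : ∀ i, a (n + 1 + i) = a (n + (i + 1)) := fun i => by congr 1; omega
      simp only [h3] at h2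
      have h4 := norm_sub_le (iteratedDeriv m (F (n + 1)) (x + a n))
        (iteratedDeriv m (F (n + 1)) (x - a n))
      have h5 := h2 (x + a n)
      have h6 := h2 (x - a n)
      have h7 := ha n
      rw [inv_mul_le_iff₀ (by linarith), add_zero]
      have h8 : 2 * a n * (C * ((∏ i ∈ Finset.range m, (a (n + (i + 1)))⁻¹) * (a n)⁻¹)) =
          2 * (C * ∏ i ∈ Finset.range m, (a (n + (i + 1)))⁻¹) := by field_simp
      rw [h8]
      linarith

/-! ### Bump functions from non-quasi-analyticity -/

/-- Shrinking finitely many terms makes the sum of a positive summable sequence small. -/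
lemma exists_small_tsum {b : ℕ → ℝ} (hb : ∀ n, 0 < b n) (hs : Summable b) {δ : ℝ} (hδ : 0 < δ) :
    ∃ (a : ℕ → ℝ) (C : ℝ), (∀ n, 0 < a n) ∧ Summable a ∧ ∑' n, a n < δ ∧ 0 ≤ C ∧
      ∀ m, ∏ i ∈ Finset.range m, (a i)⁻¹ ≤ C * ∏ i ∈ Finset.range m, (b i)⁻¹ := by
  obtain ⟨N, hN⟩ := ((tendsto_sum_nat_add b).eventually_lt_const (half_pos hδ)).exists
  obtain ⟨c, hc0, hc1, hc⟩ : ∃ c : ℝ, 0 < c ∧ c ≤ 1 ∧ c * ∑ i ∈ Finset.range N, b i < δ / 2 := by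
    set S := ∑ i ∈ Finset.range N, b i
    have hS : 0 ≤ S := Finset.sum_nonneg fun i _ => (hb i).le
    -- `S + 1` rather than `S`, since `S = 0` when `N = 0`.
    refine ⟨min 1 (δ / (2 * (S + 1))), by positivity, min_le_left _ _, ?_⟩
    calc min 1 (δ / (2 * (S + 1))) * S ≤ δ / (2 * (S + 1)) * S :=
          mul_le_mul_of_nonneg_right (min_le_right _ _) hS
      _ < δ / (2 * (S + 1)) * (S + 1) := mul_lt_mul_of_pos_left (by linarith) (by positivity)
      _ = δ / 2 := by field_simp
  let s : ℕ → ℝ := fun i => if i < N then c else 1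
  have hs0 : ∀ i, 0 < s i := fun i => by simp only [s]; split_ifs <;> linarith
  have hs1 : ∀ i, s i ≤ 1 := fun i => by simp only [s]; split_ifs <;> linarith
  have hsum : Summable fun i => s i * b i :=
    Summable.of_nonneg_of_le (fun i => mul_nonneg (hs0 i).le (hb i).le)
      (fun i => mul_le_of_le_one_left (hb i).le (hs1 i)) hs
  refine ⟨fun i => s i * b i, (c⁻¹) ^ N, fun i => mul_pos (hs0 i) (hb i), hsum, ?_,
    by positivity, fun m => ?_⟩
  · rw [← hsum.sum_add_tsum_nat_add N]
    have h1 : ∑ i ∈ Finset.range N, s i * b i = c * ∑ i ∈ Finset.range N, b i := by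
      rw [Finset.mul_sum]
      refine Finset.sum_congr rfl fun i hi => ?_
      simp [s, Finset.mem_range.1 hi]
    have h2 : ∀ i, s (i + N) * b (i + N) = b (i + N) := fun i => by simp [s]
    simp only [h1, h2]
    linarith
  · simp only [mul_inv, Finset.prod_mul_distrib]
    refine mul_le_mul_of_nonneg_right ?_ (Finset.prod_nonneg fun i _ => (inv_pos.2 (hb i)).le)
    have h1 : ∀ i, (s i)⁻¹ = if i < N then c⁻¹ else 1 := fun i => by
      simp only [s]; split_ifs <;> simp
    simp only [h1]
    rw [Finset.prod_ite, Finset.prod_const, Finset.prod_const_one, mul_one]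
    refine pow_le_pow_right₀ ((one_le_inv₀ hc0).2 hc1) ?_
    calc _ ≤ (Finset.range N).card := Finset.card_le_card fun i hi => by
            simpa using (Finset.mem_filter.1 hi).2
      _ = N := Finset.card_range N

/-- A non-quasi-analytic weight sequence admits bump functions. -/
theorem WeightSeq.NonQuasiAnalytic.exists_bump {M : WeightSeq} (hM : M.NonQuasiAnalytic) {δ : ℝ}
    (hδ : 0 < δ) : ∃ (χ : ℝ → ℂ) (B : ℕ → ℝ), ContDiff ℝ (⊤ : ℕ∞) χ ∧ χ 0 ≠ 0 ∧
      (∀ x, δ ≤ |x| → χ x = 0) ∧ (∀ n x, ‖iteratedDeriv n χ x‖ ≤ B n) ∧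
      Summable fun n => B n / M.seq n := by
  -- The factor 2 makes the product of inverses telescope to `(1 / 2) ^ n * M n`, so that division
  -- by `M n` leaves a geometric series.
  have hb : ∀ n, 0 < 2 * (M.seq n / M.seq (n + 1)) := fun n =>
    mul_pos two_pos (div_pos (M.pos _) (M.pos _))
  obtain ⟨a, C, ha, hs, hsum, hC, hprod⟩ :=
    exists_small_tsum hb (hM.mul_left 2) (half_pos hδ)
  obtain ⟨F, hFd, hF, hF0, hFz⟩ := exists_boxConvolution ha hs hsum
  have hreg := fun m => contDiff_and_norm_iteratedDeriv_le ha hFd hF m 0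
  refine ⟨F 0, fun n => δ / 2 * ∏ i ∈ Finset.range n, (a i)⁻¹,
    contDiff_infty.2 fun m => (hreg m).1, hF0, fun x hx => hFz x (by linarith),
    fun n x => by simpa using (hreg n).2 x, ?_⟩
  have htel : ∀ n, ∏ i ∈ Finset.range n, (2 * (M.seq i / M.seq (i + 1)))⁻¹ =
      (1 / 2) ^ n * M.seq n := fun n => by
    induction n with
    | zero => simp [M.zero_eq_one]
    | succ n ih =>
      have := (M.pos n).ne'
      rw [Finset.prod_range_succ, ih, pow_succ]
      field_simp
  refine Summable.of_nonneg_of_le (fun n => ?_) (fun n => ?_)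
    ((summable_geometric_of_lt_one (r := (1 / 2 : ℝ)) (by norm_num) (by norm_num)).mul_left
      (δ / 2 * C))
  · exact div_nonneg (mul_nonneg (half_pos hδ).le
      (Finset.prod_nonneg fun i _ => (inv_pos.2 (ha i)).le)) (M.pos n).le
  · rw [div_le_iff₀ (M.pos n)]
    have h1 := hprod n
    rw [htel] at h1
    calc δ / 2 * ∏ i ∈ Finset.range n, (a i)⁻¹ ≤ δ / 2 * (C * ((1 / 2) ^ n * M.seq n)) :=
          mul_le_mul_of_nonneg_left h1 (half_pos hδ).le
      _ = _ := by ring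

/-! ### Localization and translation in `D([a, b], M)` -/

namespace DAlg

open Filter Topology

section

variable {a b : ℝ} {hab : a < b} {M : WeightSeq}

/-- The element of `D([a, b], M)` given by a function in the underlying subalgebra. -/
def ofMem {f : Icc a b → ℂ} (hf : f ∈ subalgebra hab M) : DAlg hab M :=
  (⟨f, hf⟩ : subalgebra hab M)

/-- If `w` is smooth on the line, its restriction to `[a, b]` is smooth. -/
lemma smooth_restrict (hab : a < b) {w : ℝ → ℂ} (hw : ContDiff ℝ (⊤ : ℕ∞) w) :
    Smooth hab fun x => w x :=
  hw.contDiffOn.congr fun x hx => by rw [Set.IccExtend_of_mem hab.le _ hx]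

lemma nthDeriv_restrict (hab : a < b) {w : ℝ → ℂ} (hw : ContDiff ℝ (⊤ : ℕ∞) w) (n : ℕ)
    (x : Icc a b) : nthDeriv hab n (fun x => w x) x = iteratedDeriv n w x := by
  have h : Set.EqOn (IccExtend hab.le fun x : Icc a b => w x) w (Icc a b) := fun x hx => by
    rw [Set.IccExtend_of_mem hab.le _ hx]
  rw [nthDeriv, iteratedDerivWithin_congr h x.2]
  exact iteratedDerivWithin_eq_iteratedDeriv (uniqueDiffOn_Icc hab)
    (hw.contDiffAt.of_le (by exact_mod_cast le_top)) x.2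

/-- The cutoff vanishes near `a` and `b`, where the constant extension of `f` may fail to be smooth.
-/
lemma contDiff_cutoff_mul (hab : a < b) {ψ : ℝ → ℂ} (hψ : ContDiff ℝ (⊤ : ℕ∞) ψ) {c d : ℝ}
    (hac : a < c) (hdb : d < b) (hz : ∀ u, u ∉ Icc c d → ψ u = 0) {f : Icc a b → ℂ}
    (hf : Smooth hab f) : ContDiff ℝ (⊤ : ℕ∞) fun u => ψ u * IccExtend hab.le f u := by
  refine contDiff_iff_contDiffAt.2 fun u => ?_
  by_cases hu : u ∈ Icc c d
  · exact hψ.contDiffAt.mul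
      (hf.contDiffAt (Icc_mem_nhds (hac.trans_le hu.1) (hu.2.trans_lt hdb)))
  · refine (contDiffAt_const (c := (0 : ℂ))).congr_of_eventuallyEq ?_
    filter_upwards [isClosed_Icc.isOpen_compl.mem_nhds hu] with v hv
    rw [hz v hv, zero_mul]

lemma norm_iteratedDeriv_cutoff_mul_le (hab : a < b) {ψ : ℝ → ℂ} (hψ : ContDiff ℝ (⊤ : ℕ∞) ψ)
    {c d : ℝ} (hac : a < c) (hdb : d < b) (hz : ∀ u, u ∉ Icc c d → ψ u = 0) {B : ℕ → ℝ}
    (hB : ∀ n u, ‖iteratedDeriv n ψ u‖ ≤ B n) {f : Icc a b → ℂ} (hf : Smooth hab f) (n : ℕ)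
    (u : ℝ) : ‖iteratedDeriv n (fun u => ψ u * IccExtend hab.le f u) u‖ ≤
      ∑ i ∈ Finset.range (n + 1), (n.choose i : ℝ) * B i * derivSup hab (n - i) f := by
  have hB0 : ∀ n, 0 ≤ B n := fun n => (norm_nonneg _).trans (hB n 0)
  have hsm := contDiff_cutoff_mul hab hψ hac hdb hz hf
  by_cases hu : u ∈ Icc a b
  · have hU := uniqueDiffOn_Icc hab
    have h1 := norm_iteratedFDerivWithin_mul_le (n := n) hψ.contDiffOn hf hU hu
      (by exact_mod_cast le_top)
    simp only [norm_iteratedFDerivWithin_eq_norm_iteratedDerivWithin] at h1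
    rw [iteratedDerivWithin_eq_iteratedDeriv hU
      (hsm.contDiffAt.of_le (by exact_mod_cast le_top)) hu] at h1
    refine h1.trans (Finset.sum_le_sum fun i _ => ?_)
    rw [iteratedDerivWithin_eq_iteratedDeriv hU
      (hψ.contDiffAt.of_le (by exact_mod_cast le_top)) hu]
    have h2 : ‖iteratedDerivWithin (n - i) (IccExtend hab.le f) (Icc a b) u‖ ≤
        derivSup hab (n - i) f := norm_le_derivSup hab (n - i) hf ⟨u, hu⟩
    have h3 := hB i u
    have h4 := hB0 i
    gcongr
  · have h1 : (fun u => ψ u * IccExtend hab.le f u) =ᶠ[𝓝 u] fun _ => 0 := by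
      filter_upwards [isClosed_Icc.isOpen_compl.mem_nhds hu] with v hv
      rw [hz v fun h => hv ⟨hac.le.trans h.1, h.2.trans hdb.le⟩, zero_mul]
    rw [h1.iteratedDeriv_eq n]
    simp only [iteratedDeriv_fun_const_zero, norm_zero]
    exact Finset.sum_nonneg fun i _ =>
      mul_nonneg (mul_nonneg (Nat.cast_nonneg _) (hB0 i)) (derivSup_nonneg hab _ f)

/-- The restriction of a smooth function whose derivatives obey a Leibniz-type bound belongs to
`D([a, b], M)`. -/
lemma exists_restrict_norm_le {w : ℝ → ℂ} (hw : ContDiff ℝ (⊤ : ℕ∞) w) {B : ℕ → ℝ}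
    (hB0 : ∀ n, 0 ≤ B n) (hsum : Summable fun n => B n / M.seq n) (f : DAlg hab M)
    (hwn : ∀ n x, ‖iteratedDeriv n w x‖ ≤
      ∑ i ∈ Finset.range (n + 1), (n.choose i : ℝ) * B i * derivSup hab (n - i) f) :
    ∃ g : DAlg hab M, ‖g‖ ≤ (∑' n, B n / M.seq n) * ‖f‖ ∧ ∀ y : Icc a b, g y = w y := by
  let g : Icc a b → ℂ := fun y => w y
  have hg : Smooth hab g := smooth_restrict hab hw
  -- The binomial weights are absorbed by `M.choose_le`, which leaves a Cauchy product as in the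
  -- submultiplicativity of the norm.
  have hterm : ∀ n, term hab M g n ≤
      ∑ p ∈ Finset.HasAntidiagonal.antidiagonal n, B p.1 / M.seq p.1 * term hab M f p.2 := by
    intro n
    rw [Finset.Nat.sum_antidiagonal_eq_sum_range_succ_mk]
    unfold term
    rw [div_le_iff₀ (M.pos n), Finset.sum_mul]
    refine derivSup_le hab fun x => ?_
    rw [nthDeriv_restrict hab hw]
    refine (hwn n _).trans (Finset.sum_le_sum fun i hi => ?_)
    have hin : i + (n - i) = n := by have := Finset.mem_range.1 hi; omega
    have h3 := M.choose_le i (n - i)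
    rw [hin] at h3
    have hA := hB0 i
    have hD := derivSup_nonneg hab (n - i) f
    calc (n.choose i : ℝ) * B i * derivSup hab (n - i) f
        ≤ (M.seq n / (M.seq i * M.seq (n - i))) * B i * derivSup hab (n - i) f := by gcongr
      _ = _ := by
        have := (M.pos i).ne'
        have := (M.pos (n - i)).ne'
        field_simp
  have hs : Summable fun p : ℕ × ℕ => B p.1 / M.seq p.1 * term hab M f p.2 :=
    hsum.mul_of_nonneg f.2.2 (fun n => div_nonneg (hB0 n) (M.pos n).le) (term_nonneg hab M f)
  have hs' : Summable fun n => ∑ p ∈ Finset.HasAntidiagonal.antidiagonal n,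
      B p.1 / M.seq p.1 * term hab M f p.2 :=
    summable_sum_mul_antidiagonal_of_summable_mul (f := fun n => B n / M.seq n)
      (g := term hab M f) hs
  have hgs : Summable (term hab M g) :=
    Summable.of_nonneg_of_le (term_nonneg hab M g) hterm hs'
  refine ⟨ofMem ⟨hg, hgs⟩, ?_, fun y => ?_⟩
  · rw [norm_eq, norm_eq, hsum.tsum_mul_tsum_eq_tsum_sum_antidiagonal f.2.2 hs]
    exact hgs.tsum_le_tsum hterm hs'
  · rfl

/-- Functions in `D([a, b], M)` can be localized at an interior point `x₀` and translated to `y₀`,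
with control of the norm. -/
theorem exists_localized_translate (hM : M.NonQuasiAnalytic) {x₀ : ℝ} (hx₀ : x₀ ∈ Set.Ioo a b)
    (y₀ : ℝ) : ∃ (χ : ℝ → ℂ) (C : ℝ), Continuous χ ∧ χ y₀ ≠ 0 ∧
      ∀ f : DAlg hab M, ∃ g : DAlg hab M, ‖g‖ ≤ C * ‖f‖ ∧
        ∀ y : Icc a b, g y = χ y * IccExtend hab.le f (y - y₀ + x₀) := by
  obtain ⟨δ, hδ, h1, h2⟩ : ∃ δ > 0, a < x₀ - δ ∧ x₀ + δ < b := by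
    refine ⟨min (x₀ - a) (b - x₀) / 2, ?_, ?_, ?_⟩
    · have := lt_min (sub_pos.2 hx₀.1) (sub_pos.2 hx₀.2)
      linarith
    · have := min_le_left (x₀ - a) (b - x₀)
      linarith [hx₀.1]
    · have := min_le_right (x₀ - a) (b - x₀)
      linarith [hx₀.2]
  obtain ⟨χ, B, hχ, hχ0, hχz, hB, hsum⟩ := hM.exists_bump hδ
  have hB0 : ∀ n, 0 ≤ B n := fun n => (norm_nonneg _).trans (hB n 0)
  have hψ : ContDiff ℝ (⊤ : ℕ∞) fun u => χ (u - x₀) := hχ.comp (contDiff_id.sub contDiff_const)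
  have hψz : ∀ u, u ∉ Icc (x₀ - δ) (x₀ + δ) → χ (u - x₀) = 0 := fun u hu => hχz _ <| by
    by_contra! h
    rw [abs_lt] at h
    exact hu ⟨by linarith [h.1], by linarith [h.2]⟩
  have hψB : ∀ n u, ‖iteratedDeriv n (fun u => χ (u - x₀)) u‖ ≤ B n := fun n u => by
    rw [iteratedDeriv_comp_sub_const]; exact hB n _
  refine ⟨fun y => χ (y - y₀), ∑' n, B n / M.seq n, hχ.continuous.comp (by fun_prop),
    by simpa using hχ0, fun f => ?_⟩
  let v : ℝ → ℂ := fun u => χ (u - x₀) * IccExtend hab.le f u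
  have hv : ContDiff ℝ (⊤ : ℕ∞) v := contDiff_cutoff_mul hab hψ h1 h2 hψz f.2.1
  have hw : ContDiff ℝ (⊤ : ℕ∞) fun y => v (y + (x₀ - y₀)) :=
    hv.comp (contDiff_id.add contDiff_const)
  obtain ⟨g, hg, hgv⟩ := exists_restrict_norm_le hw hB0 hsum f fun n y => by
    rw [iteratedDeriv_comp_add_const]
    exact norm_iteratedDeriv_cutoff_mul_le hab hψ h1 h2 hψz hψB f.2.1 n _
  refine ⟨g, hg, fun y => ?_⟩
  have e1 : (y : ℝ) + (x₀ - y₀) = y - y₀ + x₀ := by ring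
  have e2 : (y : ℝ) - y₀ + x₀ - x₀ = y - y₀ := by ring
  rw [hgv, e1]
  simp only [v, e2]

/-- The coordinate function belongs to `D([a, b], M)`. -/
lemma coord_mem : (fun x : Icc a b => ((x : ℝ) : ℂ)) ∈ subalgebra hab M := by
  have hw : ContDiff ℝ (⊤ : ℕ∞) fun x : ℝ => (x : ℂ) := Complex.ofRealCLM.contDiff
  refine ⟨smooth_restrict hab hw, summable_of_ne_finset_zero (s := {0, 1}) fun n hn => ?_⟩
  have hd1 : deriv (fun x : ℝ => (x : ℂ)) = fun _ => 1 :=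
    funext fun x => (Complex.ofRealCLM.hasDerivAt (x := x)).deriv.trans (by simp)
  obtain ⟨m, rfl⟩ : ∃ m, n = m + 2 := ⟨n - 2, by simp at hn; omega⟩
  have h : derivSup hab (m + 2) (fun x : Icc a b => ((x : ℝ) : ℂ)) ≤ 0 :=
    derivSup_le hab fun x => by
      rw [nthDeriv_restrict hab hw, iteratedDeriv_succ', hd1, iteratedDeriv_const]
      simp
  rw [term, le_antisymm h (derivSup_nonneg hab _ _), zero_div]

lemma norm_nthDeriv_le (f : DAlg hab M) (n : ℕ) (x : Icc a b) :
    ‖nthDeriv hab n f x‖ ≤ M.seq n * ‖f‖ := by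
  have h := f.2.2.le_tsum n fun m _ => term_nonneg hab M f m
  rw [term, div_le_iff₀ (M.pos n)] at h
  rw [mul_comm]
  exact (norm_le_derivSup hab n f.2.1 x).trans h

end

/-! ### Leading coefficients at a point -/

/-- `f x = α (x - x₀) ^ n + o((x - x₀) ^ n)` near `x₀`. -/
def HasLeadingCoeff (f : ℝ → ℂ) (x₀ : ℝ) (n : ℕ) (α : ℂ) : Prop :=
  Tendsto (fun x : ℝ => f x / ((x - x₀ : ℝ) : ℂ) ^ n) (𝓝[≠] x₀) (𝓝 α)

namespace HasLeadingCoeff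

variable {f g : ℝ → ℂ} {x₀ : ℝ} {m n : ℕ} {α β : ℂ}

lemma congr (hf : HasLeadingCoeff f x₀ n α) (h : f =ᶠ[𝓝[≠] x₀] g) : HasLeadingCoeff g x₀ n α :=
  Tendsto.congr' (h.mono fun x hx => by simp only [hx]) hf

lemma const_mul (hf : HasLeadingCoeff f x₀ n α) (c : ℂ) :
    HasLeadingCoeff (fun x => c * f x) x₀ n (c * α) :=
  (Tendsto.const_mul c hf).congr fun x => by rw [mul_div_assoc]

lemma sub (hf : HasLeadingCoeff f x₀ n α) (hg : HasLeadingCoeff g x₀ n β) :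
    HasLeadingCoeff (fun x => f x - g x) x₀ n (α - β) :=
  (Tendsto.sub hf hg).congr fun x => by rw [sub_div]

lemma of_lt (hf : HasLeadingCoeff f x₀ m α) (hnm : n < m) : HasLeadingCoeff f x₀ n 0 := by
  have h0 : Tendsto (fun x : ℝ => ((x - x₀ : ℝ) : ℂ) ^ (m - n)) (𝓝[≠] x₀) (𝓝 0) := by
    have : Continuous fun x : ℝ => ((x - x₀ : ℝ) : ℂ) ^ (m - n) := by fun_prop
    have h := this.tendsto x₀
    rw [sub_self, Complex.ofReal_zero, zero_pow (by omega)] at h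
    exact h.mono_left nhdsWithin_le_nhds
  have h := Tendsto.mul hf h0
  rw [mul_zero] at h
  refine h.congr' ?_
  filter_upwards [self_mem_nhdsWithin] with x hx
  have hxne : ((x - x₀ : ℝ) : ℂ) ≠ 0 := Complex.ofReal_ne_zero.2 (sub_ne_zero.2 hx)
  have : ((x - x₀ : ℝ) : ℂ) ^ m = ((x - x₀ : ℝ) : ℂ) ^ n * ((x - x₀ : ℝ) : ℂ) ^ (m - n) := by
    rw [← pow_add]; congr 1; omega
  rw [this]
  field_simp

/-- The leading coefficient of a weighted composite `χ (p x) * f (p x + x₀ - p x₀)`. -/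
lemma comp (hf : HasLeadingCoeff f x₀ n α) {χ : ℝ → ℂ} {p : ℝ → ℝ} {l : ℝ}
    (hp : HasDerivAt p l x₀) (hl : l ≠ 0) (hχ : Continuous χ) :
    HasLeadingCoeff (fun x => χ (p x) * f (p x - p x₀ + x₀)) x₀ n (χ (p x₀) * α * (l : ℂ) ^ n) := by
  have h1 : Tendsto (fun x => p x - p x₀ + x₀) (𝓝[≠] x₀) (𝓝[≠] x₀) := by
    have hd : HasDerivAt (fun x => p x - p x₀ + x₀) l x₀ := (hp.sub_const _).add_const _
    simpa using hd.tendsto_nhdsNE hl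
  have h2 : Tendsto (fun x => χ (p x)) (𝓝[≠] x₀) (𝓝 (χ (p x₀))) :=
    (hχ.continuousAt.comp hp.continuousAt).tendsto.mono_left nhdsWithin_le_nhds
  have h3 : Tendsto (fun x => ((slope p x₀ x : ℝ) : ℂ) ^ n) (𝓝[≠] x₀) (𝓝 ((l : ℂ) ^ n)) :=
    ((Complex.continuous_ofReal.tendsto l).comp (hasDerivAt_iff_tendsto_slope.1 hp)).pow n
  -- Since `l ≠ 0`, `p x ≠ p x₀` for `x ≠ x₀` near `x₀`, so the quotient factors through `(p x - p
  -- x₀) ^ n` and the `n`-th power of the slope.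
  refine ((h2.mul (Tendsto.comp hf h1)).mul h3).congr' ?_
  filter_upwards [self_mem_nhdsWithin, h1 self_mem_nhdsWithin] with x hx hpx
  have hxne : ((x - x₀ : ℝ) : ℂ) ≠ 0 := Complex.ofReal_ne_zero.2 (sub_ne_zero.2 hx)
  have hp' : ((p x - p x₀ : ℝ) : ℂ) ≠ 0 := Complex.ofReal_ne_zero.2 fun h => hpx <| by
    simp only [h, zero_add, Set.mem_singleton_iff]
  simp only [Function.comp_apply, slope_def_field, add_sub_cancel_right, Complex.ofReal_div, div_pow]
  field_simp

end HasLeadingCoeff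

section

variable {a b x₀ : ℝ}

/-- Taylor's formula for a function whose derivatives below order `k` vanish at `x₀`. -/
lemma hasLeadingCoeff_of_iteratedDerivWithin {f : ℝ → ℂ} (hf : ContDiffOn ℝ (⊤ : ℕ∞) f (Icc a b))
    (hx₀ : x₀ ∈ Set.Ioo a b) {k : ℕ} (h : ∀ j < k, iteratedDerivWithin j f (Icc a b) x₀ = 0) :
    HasLeadingCoeff f x₀ k ((k.factorial : ℂ)⁻¹ * iteratedDerivWithin k f (Icc a b) x₀) := by
  set D := iteratedDerivWithin k f (Icc a b) x₀
  have ht := taylor_tendsto (n := k) (convex_Icc a b) (Set.Ioo_subset_Icc_self hx₀)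
    (hf.of_le (by exact_mod_cast le_top))
  rw [nhdsWithin_eq_nhds.2 (Icc_mem_nhds hx₀.1 hx₀.2)] at ht
  have ht' := (ht.mono_left (nhdsWithin_le_nhds (s := {x₀}ᶜ))).add_const
    ((k.factorial : ℂ)⁻¹ * D)
  rw [zero_add] at ht'
  refine ht'.congr' ?_
  filter_upwards [self_mem_nhdsWithin] with x hx
  have hxne : ((x - x₀ : ℝ) : ℂ) ≠ 0 := Complex.ofReal_ne_zero.2 (sub_ne_zero.2 hx)
  have he : taylorWithinEval f k (Icc a b) x₀ x =
      (k.factorial : ℂ)⁻¹ * ((x - x₀ : ℝ) : ℂ) ^ k * D := by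
    rw [taylor_within_apply, Finset.sum_range_succ, Finset.sum_eq_zero fun j hj => by
      rw [h j (Finset.mem_range.1 hj), smul_zero], zero_add, Complex.real_smul]
    push_cast
    rfl
  rw [he, Complex.real_smul, Complex.ofReal_inv, Complex.ofReal_pow]
  field_simp
  ring

/-- By strong induction the lower derivatives vanish, because their leading coefficients are 0 by
`of_lt`; Taylor's formula and uniqueness of limits then give the `n`-th. -/
lemma HasLeadingCoeff.iteratedDerivWithin_eq {f : ℝ → ℂ}
    (hf : ContDiffOn ℝ (⊤ : ℕ∞) f (Icc a b)) (hx₀ : x₀ ∈ Set.Ioo a b) {n : ℕ} {α : ℂ}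
    (h : HasLeadingCoeff f x₀ n α) :
    iteratedDerivWithin n f (Icc a b) x₀ = n.factorial * α := by
  have key : ∀ k β, (∀ j < k, iteratedDerivWithin j f (Icc a b) x₀ = 0) →
      HasLeadingCoeff f x₀ k β → iteratedDerivWithin k f (Icc a b) x₀ = k.factorial * β := by
    intro k β hk hβ
    rw [tendsto_nhds_unique hβ (hasLeadingCoeff_of_iteratedDerivWithin hf hx₀ hk)]
    rw [mul_inv_cancel_left₀ (Nat.cast_ne_zero.2 k.factorial_ne_zero)]
  refine key n α (fun j hj => ?_) h
  induction j using Nat.strong_induction_on with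
  | _ j ih =>
    rw [key j 0 (fun i hi => ih i hi (hi.trans hj)) (h.of_lt hj), mul_zero]

/-! ### Almost minimal functions and failure of compactness -/

variable {hab : a < b} {M : WeightSeq}

/-- Keeps the infimum in `exists_almost_minimal` positive. -/
lemma factorial_le_of_hasLeadingCoeff (hx₀ : x₀ ∈ Set.Ioo a b) (f : DAlg hab M) {n : ℕ}
    (h : HasLeadingCoeff (IccExtend hab.le f) x₀ n 1) : n.factorial / M.seq n ≤ ‖f‖ := by
  have h1 := norm_nthDeriv_le f n ⟨x₀, Set.Ioo_subset_Icc_self hx₀⟩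
  rw [nthDeriv, h.iteratedDerivWithin_eq f.2.1 hx₀] at h1
  rw [div_le_iff₀ (M.pos n), mul_comm]
  simpa using h1

lemma eventually_mem_Icc (hx₀ : x₀ ∈ Set.Ioo a b) : ∀ᶠ x in 𝓝[≠] x₀, x ∈ Icc a b :=
  nhdsWithin_le_nhds (Icc_mem_nhds hx₀.1 hx₀.2)

lemma exists_hasLeadingCoeff (hx₀ : x₀ ∈ Set.Ioo a b) (n : ℕ) :
    ∃ f : DAlg hab M, HasLeadingCoeff (IccExtend hab.le f) x₀ n 1 := by
  let z : DAlg hab M := ofMem (coord_mem (hab := hab) (M := M))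
  refine ⟨(z - algebraMap ℂ (DAlg hab M) x₀) ^ n, ?_⟩
  refine tendsto_const_nhds.congr' ?_
  filter_upwards [self_mem_nhdsWithin, eventually_mem_Icc hx₀] with x hx hxI
  have hxne : ((x - x₀ : ℝ) : ℂ) ≠ 0 := Complex.ofReal_ne_zero.2 (sub_ne_zero.2 hx)
  rw [Set.IccExtend_of_mem hab.le _ hxI]
  change 1 = ((x : ℂ) - (x₀ : ℂ)) ^ n / _
  rw [← Complex.ofReal_sub, div_self (pow_ne_zero _ hxne)]

/-- An almost norm-minimal function with leading term `(x - x₀) ^ n`. -/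
lemma exists_almost_minimal (hx₀ : x₀ ∈ Set.Ioo a b) (n : ℕ) :
    ∃ f : DAlg hab M, 0 < ‖f‖ ∧ HasLeadingCoeff (IccExtend hab.le f) x₀ n 1 ∧
      ∀ (g : DAlg hab M) (β : ℂ), HasLeadingCoeff (IccExtend hab.le g) x₀ n β →
        ‖β‖ * ‖f‖ ≤ 2 * ‖g‖ := by
  let S : Set ℝ := {r | ∃ f : DAlg hab M, HasLeadingCoeff (IccExtend hab.le f) x₀ n 1 ∧ ‖f‖ = r}
  obtain ⟨f₀, hf₀⟩ := exists_hasLeadingCoeff (hab := hab) (M := M) hx₀ n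
  have hne : S.Nonempty := ⟨_, f₀, hf₀, rfl⟩
  have hpos : (0 : ℝ) < n.factorial / M.seq n :=
    div_pos (Nat.cast_pos.2 n.factorial_pos) (M.pos n)
  have hlb : ∀ r ∈ S, n.factorial / M.seq n ≤ r := by
    rintro _ ⟨f, hf, rfl⟩
    exact factorial_le_of_hasLeadingCoeff hx₀ f hf
  have hbdd : BddBelow S := ⟨_, hlb⟩
  have hinf : 0 < sInf S := hpos.trans_le (le_csInf hne hlb)
  -- The infimum need not be attained, hence the factor 2.
  obtain ⟨_, ⟨f, hf, rfl⟩, hfl⟩ := exists_lt_of_csInf_lt hne (by linarith : sInf S < 2 * sInf S)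
  refine ⟨f, hpos.trans_le (hlb _ ⟨f, hf, rfl⟩), hf, fun g β hg => ?_⟩
  rcases eq_or_ne β 0 with rfl | hβ
  · simp
  · have h1 : HasLeadingCoeff (IccExtend hab.le (β⁻¹ • g : DAlg hab M)) x₀ n 1 := by
      have := hg.const_mul β⁻¹
      rwa [inv_mul_cancel₀ hβ] at this
    have h2 : sInf S ≤ ‖β⁻¹ • g‖ := csInf_le hbdd ⟨_, h1, rfl⟩
    rw [norm_smul_eq, norm_inv, inv_mul_eq_div, le_div_iff₀ (norm_pos_iff.2 hβ)] at h2
    nlinarith [norm_pos_iff.2 hβ]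

/-- A selfmap with `|φ'| ≥ 1` at an interior point does not induce a compact endomorphism. -/
theorem abs_lt_one_of_inducesCompactEndomorphism (hM : M.NonQuasiAnalytic)
    {φ : Icc a b → Icc a b} (hφ : InducesCompactEndomorphism hab M φ) (hx₀ : x₀ ∈ Set.Ioo a b)
    {l : ℝ} (hl : HasDerivAt (realMap hab φ) l x₀) : |l| < 1 := by
  by_contra! hl1
  have hl0 : l ≠ 0 := fun h => by simp [h] at hl1; linarith
  obtain ⟨T, hT, hcomp⟩ := hφ
  obtain ⟨χ, C, hχ, hχ0, hS⟩ :=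
    exists_localized_translate (hab := hab) hM hx₀ (realMap hab φ x₀)
  choose S hSn hSv using hS
  choose f hf0 hf hmin using fun n => exists_almost_minimal (hab := hab) (M := M) hx₀ n
  have hTS : ∀ n, HasLeadingCoeff (IccExtend hab.le (T (S (f n)))) x₀ n
      (χ (realMap hab φ x₀) * 1 * (l : ℂ) ^ n) := fun n => by
    refine ((hf n).comp hl hl0 hχ).congr ?_
    filter_upwards [eventually_mem_Icc hx₀] with x hx
    rw [Set.IccExtend_of_mem hab.le _ hx, hT, hSv]
    have : realMap hab φ x = φ ⟨x, hx⟩ := Set.IccExtend_of_mem hab.le _ hx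
    rw [this]
  let u : ℕ → DAlg hab M := fun n => ((‖f n‖⁻¹ : ℝ) : ℂ) • S (f n)
  have hnorm : ∀ n, ‖((‖f n‖⁻¹ : ℝ) : ℂ)‖ = ‖f n‖⁻¹ := fun n => by
    rw [Complex.norm_real, norm_inv, norm_norm]
  have hu : ∀ n, u n ∈ Metric.closedBall (0 : DAlg hab M) C := fun n => by
    rw [mem_closedBall_zero_iff, norm_smul_eq, hnorm, inv_mul_le_iff₀ (hf0 n), mul_comm]
    exact hSn (f n)
  have hTu : ∀ n, HasLeadingCoeff (IccExtend hab.le (T (u n))) x₀ n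
      (((‖f n‖⁻¹ : ℝ) : ℂ) * (χ (realMap hab φ x₀) * 1 * (l : ℂ) ^ n)) := fun n => by
    have h := (hTS n).const_mul ((‖f n‖⁻¹ : ℝ) : ℂ)
    simp only [u, map_smul]
    exact h
  -- `T (u m)` vanishes to higher order and contributes nothing at order `n`; almost minimality of
  -- `f n` cancels the normalization, and `|l| ^ n ≥ 1`.
  have hsep : ∀ n m, n < m → ‖χ (realMap hab φ x₀)‖ ≤ 2 * ‖T (u n) - T (u m)‖ := fun n m hnm => by
    have h := (hTu n).sub ((hTu m).of_lt hnm)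
    rw [sub_zero] at h
    have h1 := hmin n (T (u n) - T (u m)) _ h
    rw [norm_mul, hnorm, mul_one, norm_mul, norm_pow, Complex.norm_real, Real.norm_eq_abs] at h1
    refine le_trans ?_ h1
    have h2 : ‖f n‖⁻¹ * (‖χ (realMap hab φ x₀)‖ * |l| ^ n) * ‖f n‖ =
        ‖χ (realMap hab φ x₀)‖ * |l| ^ n := by
      have := (hf0 n).ne'
      field_simp
    rw [h2]
    exact le_mul_of_one_le_right (norm_nonneg _) (one_le_pow₀ hl1)
  obtain ⟨K, hK, hKs⟩ := IsCompactOperator.image_closedBall_subset_compact (𝕜₁ := ℂ)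
    (f := T.toLinearMap) hcomp C
  obtain ⟨y, -, ι, hι, hy⟩ := hK.tendsto_subseq (x := fun n => T (u n))
    fun n => hKs ⟨u n, hu n, rfl⟩
  have hχpos := norm_pos_iff.2 hχ0
  obtain ⟨N, hN⟩ := Metric.cauchySeq_iff'.1 hy.cauchySeq (‖χ (realMap hab φ x₀)‖ / 2)
    (half_pos hχpos)
  have h1 := hN (N + 1) (Nat.le_succ N)
  rw [dist_comm, dist_eq_norm] at h1
  have h2 := hsep (ι N) (ι (N + 1)) (hι (Nat.lt_succ_self N))
  simp only [Function.comp_apply] at h1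
  linarith

/-- `φ` is the image under `T` of the coordinate function, hence smooth. -/
lemma differentiableOn_realMap {φ : Icc a b → Icc a b} (hφ : InducesCompactEndomorphism hab M φ) :
    DifferentiableOn ℝ (realMap hab φ) (Icc a b) := by
  obtain ⟨T, hT, -⟩ := hφ
  let z : DAlg hab M := ofMem (coord_mem (hab := hab) (M := M))
  have h1 : DifferentiableOn ℝ (IccExtend hab.le (T z)) (Icc a b) :=
    (T z).2.1.differentiableOn (by simp)
  refine (Complex.reCLM.differentiable.comp_differentiableOn h1).congr fun x hx => ?_
  rw [realMap, Set.IccExtend_of_mem hab.le _ hx, Function.comp_apply,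
    Set.IccExtend_of_mem hab.le _ hx, hT]
  exact (Complex.ofReal_re _).symm

lemma abs_selfmapDeriv_lt_one (hM : M.NonQuasiAnalytic) {φ : Icc a b → Icc a b}
    (hφ : InducesCompactEndomorphism hab M φ) (x : Icc a b) (hx : (x : ℝ) ∈ Set.Ioo a b) :
    |selfmapDeriv hab φ x| < 1 :=
  abs_lt_one_of_inducesCompactEndomorphism hM hφ hx
    ((differentiableOn_realMap hφ x x.2).hasDerivWithinAt.hasDerivAt (Icc_mem_nhds hx.1 hx.2))

end

end DAlg

theorem theorem1p5 (M : WeightSeq) (hM : M.NonQuasiAnalytic)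
    (φ : Set.Icc (0 : ℝ) 1 → Set.Icc (0 : ℝ) 1)
    (hφ : DAlg.InducesCompactEndomorphism zero_lt_one M φ) :
    DifferentiableOn ℝ (DAlg.realMap zero_lt_one φ) (Set.Icc 0 1) ∧
    (∀ x : Set.Icc (0 : ℝ) 1, (x : ℝ) ∈ Set.Ioo (0 : ℝ) 1 →
      |DAlg.selfmapDeriv zero_lt_one φ x| < 1) ∧
    ((∃ x₀ : Set.Icc (0 : ℝ) 1, (x₀ : ℝ) ∈ Set.Ioo (0 : ℝ) 1 ∧
        ∀ x, |DAlg.selfmapDeriv zero_lt_one φ x| ≤ |DAlg.selfmapDeriv zero_lt_one φ x₀|) →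
      (⨆ x, |DAlg.selfmapDeriv zero_lt_one φ x|) < 1) := by
  have h := DAlg.abs_selfmapDeriv_lt_one hM hφ
  exact ⟨DAlg.differentiableOn_realMap hφ, h,
    fun ⟨x₀, hx₀, hmax⟩ => (ciSup_le hmax).trans_lt (h x₀ hx₀)⟩
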